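/- All graphs are finite, simple and undirected. For a graph $G$, $\mathrm{dist}_G(u,v)\in\mathbb N\cup\{\infty\}$ denotes the length of a shortest path between $u$ and $v$ ($\infty$ if there is none). A *merge sequence* for a graph $G=(V,E)$ is a sequence $(\mathcal P_1,R_1),\dots,(\mathcal P_m,R_m)$, $m\ge 1$, where $\mathcal P_1\preceq\dots\preceq\mathcal P_m$ is a sequence of ever coarser partitions of $V$ (not necessarily distinct), $\mathcal P_1$ is the partition into singletons, $\mathcal P_m$ is the partition with the single part $V$, $R_1\subseteq\dots\subseteq R_m\subseteq\binom V2$, and for every $t\in\{1,\dots,m\}$ and all parts $A,B\in\mathcal P_t$ (possibly $A=B$), the pairs $ab\notin R_t$ with $a\in A$, $b\in B$, $a\ne b$ are either all edges or all non-edges of $G$. For $r\in\mathbb N$, the *radius-$r$ width* of the sequence is the maximum, over $1\le t<m$ and $v\in V$, of the number of parts $A\in\mathcal P_t$ containing a vertex at distance at most $r$ from $v$ in the graph $(V,R_{t+1})$. (A maximum over the empty set is $0$; the graph without vertices has the trivial merge sequences.) A class $\mathscr C$ of graphs has *universally bounded merge-width* if there is a function $f\colon\mathbb N\to\mathbb N$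 such that every $G\in\mathscr C$ has a single merge sequence whose radius-$r$ width is at most $f(r)$ for all $r\in\mathbb N$. A class $\mathscr D$ of graphs has *bounded expansion* if for every $r\in\mathbb N$ there is a constant $c$ such that $|E(H)|\le c\,|V(H)|$ for every graph $H$ that is a depth-$r$ shallow minor of some $G\in\mathscr D$, i.e. for which there are pairwise disjoint sets $B_a\subseteq V(G)$, $a\in V(H)$, such that each $G[B_a]$ is nonempty and connected of radius at most $r$, and for each edge $ab$ of $H$ there is an edge of $G$ between $B_a$ and $B_b$. For $a\ge1$, $b\ge0$, a graph $G$ is *$(a,b)$-quasi-isometric* to a graph $H$ if there is a map $\phi\colon V(G)\to V(H)$ such that $\frac1a\,\mathrm{dist}_G(x,x')-b\le\mathrm{dist}_H(\phi(x),\phi(x'))\le a\,\mathrm{dist}_G(x,x')+b$ for all $x,x'\in V(G)$, and for every $y\in V(H)$ there is $x\in V(G)$ with $\mathrm{dist}_H(y,\phi(x))\le b$. **Theorem.** Let $\mathscr C$ be a class of graphs with universally bounded merge-width. Then there is a class $\mathscr D$ of graphs of bounded expansion such that every $G\in\mathscr C$ is $(13,12)$-quasi-isometric to some $H\in\mathscr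 D$. -/

import Mathlib

open scoped NNReal ENNReal

universe u v

/-- A finite simple undirected graph. -/
structure FinGraph : Type (u + 1) where
  /-- the vertex set -/
  V : Type u
  [finite : Finite V]
  /-- the adjacency structure -/
  graph : SimpleGraph V

attribute [instance] FinGraph.finite

/-! ### Merge sequences

A partition of `V` is given by the equivalence relation `P : Setoid V` whose classes are its parts;
then `P ≤ Q` says that `P` refines `Q`, `⊥` is the partition into singletons and `⊤` is the
partition with the single part `V`. A set of unordered pairs of distinct vertices of `V` is given by
a `SimpleGraph V`; then `R ≤ R'` is inclusion of sets of pairs. -/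

/-- The ball of radius `r` around `v` in the graph `G`. -/
def graphBall {V : Type u} (G : SimpleGraph V) (r : ℕ) (v : V) : Set V :=
  {w | G.edist v w ≤ r}

/-- The quotient set `S/P`: the parts of `P` that meet the set `S`. -/
def quotientSet {V : Type u} (P : Setoid V) (S : Set V) : Set (Set V) :=
  {X | X ∈ P.classes ∧ (X ∩ S).Nonempty}

/-- `P` is homogeneous modulo `R` in `G`: for any two (possibly equal) parts `X, Y` of `P`, the
pairs `xy` with `x ∈ X`, `y ∈ Y`, `x ≠ y` outside of `R` are all edges or all non-edges of `G`. -/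
def HomogeneousModulo {V : Type u} (G : SimpleGraph V) (P : Setoid V) (R : SimpleGraph V) : Prop :=
  ∀ X ∈ P.classes, ∀ Y ∈ P.classes, ∀ x ∈ X, ∀ y ∈ Y, ∀ x' ∈ X, ∀ y' ∈ Y,
    x ≠ y → x' ≠ y' → ¬ R.Adj x y → ¬ R.Adj x' y' → (G.Adj x y ↔ G.Adj x' y')

/-- A merge sequence `(P₀, R₀), …, (Pₘ, Rₘ)` for the graph `G`. -/
structure MergeSequence {V : Type u} (G : SimpleGraph V) where
  /-- the index of the last step (the steps are numbered from `0`) -/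
  m : ℕ
  /-- the partitions -/
  P : Fin (m + 1) → Setoid V
  /-- the sets of resolved pairs -/
  R : Fin (m + 1) → SimpleGraph V
  P_mono : Monotone P
  P_first : P 0 = ⊥
  P_last : P (Fin.last m) = ⊤
  R_mono : Monotone R
  homogeneous : ∀ t, HomogeneousModulo G (P t) (R t)

/-- The radius-`r` width of `(P, R)`: the maximum, over all vertices `v`, of the number of parts
of `P` that meet the ball of radius `r` around `v` in the graph `(V, R)`. -/
noncomputable def pairWidth {V : Type u} (P : Setoid V) (R : SimpleGraph V) (r : ℕ) : ℕ∞ :=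
  ⨆ v : V, (quotientSet P (graphBall R r v)).encard

/-- The radius-`r` width of a merge sequence: the maximum of the radius-`r` widths of
`(Pₜ, Rₜ₊₁)` over all steps `t` but the last one. -/
noncomputable def MergeSequence.width {V : Type u} {G : SimpleGraph V} (S : MergeSequence G)
    (r : ℕ) : ℕ∞ :=
  ⨆ t : Fin S.m, pairWidth (S.P t.castSucc) (S.R t.succ) r

/-- A class of graphs has universally bounded merge-width if there is `f : ℕ → ℕ` such that every
graph of the class has one merge sequence whose radius-`r` width is at most `f r` for all `r`. -/
def UniversallyBoundedMergeWidth (C : Set FinGraph.{u}) : Prop :=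
  ∃ f : ℕ → ℕ, ∀ G ∈ C, ∃ S : MergeSequence G.graph, ∀ r : ℕ, S.width r ≤ f r

/-! ### Bounded expansion -/

/-- `H` is a shallow minor of `G` at depth `r`: there are pairwise disjoint vertex sets of `G`, one
for each vertex of `H`, each of which induces a subgraph of radius at most `r` (in particular
it is nonempty and connected), such that for every edge of `H` there is an edge of `G` between the
corresponding two sets. -/
def IsShallowMinor {W : Type v} {V : Type u} (r : ℕ) (H : SimpleGraph W) (G : SimpleGraph V) :
    Prop :=
  ∃ B : W → Set V,
    (∀ a b, a ≠ b → Disjoint (B a) (B b)) ∧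
    (∀ a, (G.induce (B a)).radius ≤ r) ∧
    (∀ a b, H.Adj a b → ∃ x ∈ B a, ∃ y ∈ B b, G.Adj x y)

/-- A class of graphs has bounded expansion if for every `r` there is a constant `c` such that
all shallow minors at depth `r` of graphs in the class have at most `c` times as many edges
as vertices. -/
def BoundedExpansion (D : Set FinGraph.{u}) : Prop :=
  ∀ r : ℕ, ∃ c : ℕ, ∀ G ∈ D, ∀ H : FinGraph.{u}, IsShallowMinor r H.graph G.graph →
    H.graph.edgeSet.ncard ≤ c * Nat.card H.V

/-! ### Quasi-isometries -/

/-- `φ` is an `(a, b)`-quasi-isometry from `G` to `H` (where `a ≥ 1` and `b ≥ 0`), for the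
shortest-path distances with values in `[0, ∞]`, the distance between vertices in different
components being `∞`. The lower bound `dist x x' / a - b ≤ dist (φ x) (φ x')` is written without
subtraction. -/
def IsQuasiIsometry {V : Type u} {W : Type v} (a b : ℝ≥0) (G : SimpleGraph V) (H : SimpleGraph W)
    (φ : V → W) : Prop :=
  (∀ x x' : V,
    (G.edist x x' : ℝ≥0∞) / (a : ℝ≥0∞) ≤ (H.edist (φ x) (φ x') : ℝ≥0∞) + (b : ℝ≥0∞) ∧
    (H.edist (φ x) (φ x') : ℝ≥0∞) ≤ (a : ℝ≥0∞) * (G.edist x x' : ℝ≥0∞) + (b : ℝ≥0∞)) ∧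
  ∀ y : W, ∃ x : V, (H.edist y (φ x) : ℝ≥0∞) ≤ (b : ℝ≥0∞)

/-- `G` is `(a, b)`-quasi-isometric to `H`. -/
def QuasiIsometric {V : Type u} {W : Type v} (a b : ℝ≥0) (G : SimpleGraph V) (H : SimpleGraph W) :
    Prop :=
  ∃ φ : V → W, IsQuasiIsometry a b G H φ

/-! ### Root times of classes in a chain of partitions -/

section Roots

/-! Let `τ v` be the last time `t` at which `v` lies on an edge of `G` whose ends are more than 3
apart in `R t` (0 if there is none). Homogeneity forces two of any three such vertices in one part
of `P t` to be at distance at most 2 in `G` (`HomogeneousModulo.near_of_mem_unresolvedVerts`). From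
this property alone, `exists_clustering` builds one partition for all times: its clusters are joined
by chains of four near pairs, so have diameter at most 8 in `G`, and carry lifetimes `ℓ ≥ τ` such
that a part at time `s` meets at most eight clusters alive at `s`.

The sparse graph is the quotient of `G` by the clusters; their bounded diameter makes the projection
a quasi-isometry. For sparsity, order the clusters by lifetime. A walk of length `k` from a cluster
`X` through clusters of lifetime at most `s = ℓ X` lifts to `R (s + 1)`, in which these clusters and
the edges at them are already short. It ends within radius `27 * k`, hence in boundedly many parts
of `P s`, each meeting at most eight clusters alive at `s`. So strong reachability is bounded for
every `k`, with one order because one merge sequence serves all radii. Bounded weak reachability and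
bounded expansion follow. -/

theorem Nat.downward_induction {Q : ℕ → Prop} (m : ℕ) (h₁ : ∀ t, m ≤ t → Q t)
    (h₂ : ∀ t < m, Q (t + 1) → Q t) (t : ℕ) : Q t := by
  rcases le_total m t with h | h
  · exact h₁ t h
  · induction h using Nat.decreasingInduction with
    | of_succ k hk ih => exact h₂ k hk ih
    | self => exact h₁ m le_rfl

open Classical in
/-- The root times at time `m - k` for the elements `W` with lifetimes `τ`: going down from time
`m`, the root time of a class is inherited from the class above it as long as the class contains an
element of `W` that survives until the root time, and is reset to the current time otherwise. -/
noncomputable def rootTimeBelow {V : Type u} (P : ℕ → Setoid V) (τ : V → ℕ) (m : ℕ) (W : Set V) :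
    ℕ → V → ℕ
  | 0, _ => m
  | k + 1, v => if ∃ w ∈ W, P (m - (k + 1)) w v ∧ rootTimeBelow P τ m W k v ≤ τ w then
      rootTimeBelow P τ m W k v else m - (k + 1)

theorem exists_rootTime {V : Type u} (P : ℕ → Setoid V) (τ : V → ℕ) (m : ℕ) (W : Set V) :
    ∃ r : ℕ → V → ℕ, (∀ t v, m ≤ t → r t v = t) ∧ ∀ t v, t < m →
      (r t v = r (t + 1) v ∧ ∃ w ∈ W, P t w v ∧ r (t + 1) v ≤ τ w) ∨
      (r t v = t ∧ ∀ w ∈ W, P t w v → τ w < r (t + 1) v) := by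
  classical
  let aux : ℕ → V → ℕ := rootTimeBelow P τ m W
  refine ⟨fun t v => if m ≤ t then t else aux (m - t) v, fun t v h => if_pos h, fun t v h => ?_⟩
  have h1 : ∀ v, (if m ≤ t + 1 then t + 1 else aux (m - (t + 1)) v) = aux (m - (t + 1)) v := by
    intro v
    split_ifs with h2
    · have : m = t + 1 := by omega
      subst this
      simp [aux, rootTimeBelow]
    · rfl
  have h2 : m - t = (m - (t + 1)) + 1 := by omega
  have h3 : m - (m - (t + 1) + 1) = t := by omega
  simp only [h1, if_neg (not_le.2 h), h2, aux, rootTimeBelow, h3]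
  split_ifs with h4 <;> rw [h3] at h4
  · exact Or.inl ⟨rfl, h4⟩
  · refine Or.inr ⟨rfl, fun w hw hwv => ?_⟩
    by_contra h5
    exact h4 ⟨w, hw, hwv, not_lt.1 h5⟩

/-- The root time `ρ v` is read off at time `τ v`. Later than that, up to `ρ v`, it is constant;
earlier, it is reset at most once, since after a reset to a time below `τ v` the element `v` itself
survives past the new root. So a class at time `t` leaves only two candidates `r₁`, `r₂` for the
root time of a member of `W` with `t ≤ ρ v`. -/
theorem exists_root {V : Type u} {P : ℕ → Setoid V} (hP : Monotone P) {τ : V → ℕ} {m : ℕ}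
    (hτ : ∀ v, τ v ≤ m) (W : Set V) :
    ∃ (ρ : V → ℕ) (r₁ r₂ : ℕ → V → ℕ), (∀ v, τ v ≤ ρ v) ∧
      (∀ v ∈ W, ∃ w ∈ W, P (τ v) w v ∧ ρ v ≤ τ w) ∧
      (∀ t u v, P t u v → r₁ t u = r₁ t v ∧ r₂ t u = r₂ t v) ∧
      ∀ v ∈ W, ∀ t ≤ ρ v, ρ v = r₁ t v ∨ ρ v = r₂ t v := by
  obtain ⟨r, hm, hr⟩ := exists_rootTime P τ m W
  have hle : ∀ t v, t ≤ r t v := by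
    intro t v
    refine Nat.downward_induction m (fun t h => (hm t v h).ge) (fun t h ih => ?_) t
    rcases hr t v h with h1 | h1 <;> omega
  have hinv : ∀ t u v, P t u v → r t u = r t v := by
    intro t u v
    refine Nat.downward_induction (Q := fun t => P t u v → r t u = r t v) m
      (fun t h _ => by rw [hm t u h, hm t v h]) (fun t h ih huv => ?_) t
    have ih := ih (hP t.le_succ huv)
    rcases hr t u h with ⟨h1, w, hw, hwu, hw'⟩ | ⟨h1, h1'⟩
    · rcases hr t v h with ⟨h2, -⟩ | ⟨-, h2⟩
      · omega
      · have := h2 w hw ((P t).trans hwu huv)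
        omega
    · rcases hr t v h with ⟨-, w, hw, hwv, hw'⟩ | ⟨h2, -⟩
      · have := h1' w hw ((P t).trans hwv ((P t).symm huv))
        omega
      · omega
  have hconst : ∀ v t s, t ≤ s → s ≤ r t v → r s v = r t v := by
    intro v t s hts
    induction s, hts using Nat.le_induction with
    | base => exact fun _ => rfl
    | succ s hs ih =>
      intro h
      have ih := ih (by omega)
      rcases le_or_gt m s with hms | hms
      · have := hm s v hms
        omega
      · rcases hr s v hms with h1 | h1 <;> omega
  -- After a single reset at `r t v`, the old value is still visible one step above it; this is the
  -- candidate `r₂`.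
  have hbelow : ∀ v ∈ W, ∀ t ≤ τ v, r t v = r (τ v) v ∨
      (r t v < τ v ∧ r (r t v + 1) v = r (τ v) v) := by
    intro v hv t
    refine Nat.downward_induction (Q := fun t => t ≤ τ v → r t v = r (τ v) v ∨
      (r t v < τ v ∧ r (r t v + 1) v = r (τ v) v)) (τ v) (fun t h h' => ?_) (fun t h ih _ => ?_) t
    · rw [le_antisymm h' h]
      exact Or.inl rfl
    · have ih := ih h
      rcases hr t v (h.trans_le (hτ v)) with h1 | h1
      · rwa [h1.1]
      · have h2 := h1.2 v hv ((P t).refl v)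
        rcases ih with h3 | h3
        · right
          rw [h1.1]
          exact ⟨h, h3⟩
        · omega
  refine ⟨fun v => r (τ v) v, r, fun t v => r (r t v + 1) v, fun v => hle _ _, fun v hv => ?_,
    fun t u v huv => ⟨hinv t u v huv, ?_⟩, fun v hv t ht => ?_⟩
  · rcases le_or_gt m (τ v) with h | h
    · exact ⟨v, hv, (P _).refl v, (hm _ v h).le⟩
    · rcases hr _ v h with ⟨h1, w, hw, hwv, hw'⟩ | ⟨h1, -⟩
      · exact ⟨w, hw, hwv, h1.le.trans hw'⟩
      · exact ⟨v, hv, (P _).refl v, h1.le⟩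
  · simp only [hinv t u v huv]
    exact hinv _ u v (hP ((hle t v).trans (Nat.le_succ _)) huv)
  · rcases le_total t (τ v) with h | h
    · rcases hbelow v hv t h with h1 | h1
      · exact Or.inl h1.symm
      · exact Or.inr h1.2.symm
    · exact Or.inl (hconst v _ _ h ht).symm

end Roots

/-! ### Clusters from the two-of-three nearness property -/

section Clustering

/-- A chain of partitions and lifetimes `τ` such that among any three elements of a class at time
`t` that live until time `t` two are near admits a partition into clusters of lifetimes `ℓ`. The
clusters are small in terms of nearness, and each class at time `s` meets at most eight clusters
that live until time `s`. -/
theorem exists_clustering {V : Type u} {P : ℕ → Setoid V} (hP : Monotone P) {τ : V → ℕ} {m : ℕ}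
    (hτ : ∀ v, τ v ≤ m) {near : V → V → Prop} (near_refl : ∀ v, near v v)
    (near_symm : ∀ u v, near u v → near v u)
    (hnear : ∀ t x y z, P t x y → P t x z → t ≤ τ x → t ≤ τ y → t ≤ τ z →
      near x y ∨ near y z ∨ near x z) :
    ∃ (Q : Setoid V) (ℓ : V → ℕ) (code : ℕ → V → Bool × Bool × Bool),
      (∀ v, τ v ≤ ℓ v) ∧ (∀ u v, Q u v → ℓ u = ℓ v) ∧ (∀ u v, Q u v → P (ℓ u) u v) ∧
      (∀ u v, Q u v → ∃ x y z, P (ℓ u) u x ∧ P (ℓ u) u y ∧ P (ℓ u) u z ∧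
        near u x ∧ near x y ∧ near y z ∧ near z v) ∧
      ∀ s u v, P s u v → s ≤ ℓ u → s ≤ ℓ v → code s u = code s v → Q u v := by
  classical
  obtain ⟨ρ, r₁, r₂, hτρ, hρ, hr, hρr⟩ := exists_root hP hτ Set.univ
  let E : Setoid V :=
    { r := fun u v => ρ u = ρ v ∧ P (ρ u) u v
      iseqv := ⟨fun v => ⟨rfl, (P _).refl v⟩, fun {u v} h => ⟨h.1.symm, h.1 ▸ (P _).symm h.2⟩,
        fun {u v w} h h' => ⟨h.1.trans h'.1, (P _).trans h.2 (h.1 ▸ h'.2)⟩⟩ }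
  let S : V → Set V := fun v => {x | P (ρ v) v x ∧ ρ v ≤ τ x}
  have hS : ∀ v, (S v).Nonempty := fun v => by
    obtain ⟨w, -, h1, h2⟩ := hρ v trivial
    exact ⟨w, hP (hτρ v) ((P _).symm h1), h2⟩
  have hSE : ∀ u v, E u v → S u = S v := by
    rintro u v ⟨h1, h2⟩
    ext x
    exact ⟨fun h => ⟨h1 ▸ (P _).trans ((P _).symm h2) h.1, h1 ▸ h.2⟩,
      fun h => ⟨(P _).trans h2 (h1 ▸ h.1), h1 ▸ h.2⟩⟩
  let a : V → V := fun v => (hS v).some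
  have haS : ∀ v, a v ∈ S v := fun v => (hS v).some_mem
  have haE : ∀ u v, E u v → a u = a v := by
    intro u v h
    have : ∀ (T T' : Set V) (h : T.Nonempty) (h' : T'.Nonempty), T = T' → h.some = h'.some := by
      rintro T T' h h' rfl
      rfl
    exact this _ _ _ _ (hSE u v h)
  -- Good elements are near a survivor in `S v`. Two survivors that are both not near the centre `a
  -- v` are near each other, so splitting by `central` leaves short chains on either side.
  let good : V → Prop := fun v => ∃ x ∈ S v, near v x
  let central : V → Prop := fun v => ∃ x ∈ S v, near v x ∧ near x (a v)
  -- A survivor `w` in the common class is near neither bad element, so these are near each other.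
  -- Among bad elements the two-of-three property thus improves to nearness of all pairs, and a
  -- second round of root times suffices.
  have hbad : ∀ t u v, ¬ good u → ¬ good v → E u v → P t u v → t ≤ τ u → t ≤ τ v → near u v := by
    have key : ∀ u v, ¬ good u → ¬ good v → E u v → P (τ v) u v → τ v ≤ τ u → near u v := by
      intro u v hu hv huv hP' hle
      obtain ⟨w, -, hw1, hw2⟩ := hρ v trivial
      have hwv : w ∈ S v := ⟨hP (hτρ v) ((P _).symm hw1), hw2⟩
      have hwu : w ∈ S u := hSE u v huv ▸ hwv
      rcases hnear (τ v) u v w hP' ((P _).trans hP' ((P _).symm hw1)) hle le_rfl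
        ((hτρ v).trans hw2) with h | h | h
      · exact h
      · exact absurd ⟨w, hwv, h⟩ hv
      · exact absurd ⟨w, hwu, h⟩ hu
    intro t u v hu hv huv hP' htu htv
    rcases le_total (τ v) (τ u) with h | h
    · exact key u v hu hv huv (hP htv hP') h
    · exact near_symm _ _ (key v u hv hu (E.symm huv) (hP htu ((P _).symm hP')) h)
  have hP' : Monotone fun t => P t ⊓ E := fun s t h => inf_le_inf_right E (hP h)
  obtain ⟨ρ', r₁', r₂', hτρ', hρ', hr', hρr'⟩ := exists_root hP' hτ {v | ¬ good v}
  have hinf : ∀ t u v, (P t ⊓ E) u v ↔ P t u v ∧ E u v := fun _ _ _ => Iff.rfl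
  simp only [hinf, Set.mem_ofPred_eq] at hρ' hr' hρr'
  have hρ'ρ : ∀ v, ¬ good v → ρ' v ≤ ρ v := by
    intro v hv
    obtain ⟨w, -, h1, h2⟩ := hρ' v hv
    exact (h2.trans (hτρ w)).trans h1.2.1.le
  have hEgood : ∀ s u v, P s u v → s ≤ ρ u → ρ u = ρ v → E u v :=
    fun s u v h1 h2 h3 => ⟨h3, hP h2 h1⟩
  let Q : Setoid V :=
    { r := fun u v => E u v ∧ (good u ↔ good v) ∧ (central u ↔ central v) ∧
        (¬ good u → ρ' u = ρ' v ∧ P (ρ' u) u v)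
      iseqv := by
        refine ⟨fun v => ⟨E.refl v, Iff.rfl, Iff.rfl, fun _ => ⟨rfl, (P _).refl v⟩⟩,
          fun {u v} h => ⟨E.symm h.1, h.2.1.symm, h.2.2.1.symm, fun hv => ?_⟩,
          fun {u v w} h h' => ⟨E.trans h.1 h'.1, h.2.1.trans h'.2.1, h.2.2.1.trans h'.2.2.1,
            fun hu => ?_⟩⟩
        · obtain ⟨h1, h2⟩ := h.2.2.2 (h.2.1.not.2 hv)
          exact ⟨h1.symm, h1 ▸ (P _).symm h2⟩
        · obtain ⟨h1, h2⟩ := h.2.2.2 hu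
          obtain ⟨h3, h4⟩ := h'.2.2.2 (h.2.1.not.1 hu)
          exact ⟨h1.trans h3, (P _).trans h2 (h1 ▸ h4)⟩ }
  obtain ⟨ℓ, hg, hb⟩ : ∃ ℓ : V → ℕ, (∀ v, good v → ℓ v = ρ v) ∧ ∀ v, ¬ good v → ℓ v = ρ' v :=
    ⟨fun v => if good v then ρ v else ρ' v, fun v h => if_pos h, fun v h => if_neg h⟩
  -- Three bits: which candidate is `ρ v`, whether `v` is good, and then either centrality or which
  -- candidate is `ρ' v`.
  refine ⟨Q, ℓ, fun s v => (decide (ρ v = r₁ s v),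
    decide (good v), if good v then decide (central v) else decide (ρ' v = r₁' s v)), ?_, ?_, ?_,
    ?_, ?_⟩
  · intro v
    by_cases h : good v
    · exact (hτρ v).trans (hg v h).ge
    · exact (hτρ' v).trans (hb v h).ge
  · rintro u v ⟨h1, h2, h3, h4⟩
    by_cases hu : good u
    · rw [hg u hu, hg v (h2.1 hu), h1.1]
    · rw [hb u hu, hb v (h2.not.1 hu), (h4 hu).1]
  · rintro u v ⟨h1, h2, h3, h4⟩
    by_cases hu : good u
    · rw [hg u hu]
      exact h1.2
    · rw [hb u hu]
      exact (h4 hu).2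
  · rintro u v ⟨h1, h2, h3, h4⟩
    by_cases hu : good u
    · rw [hg u hu]
      by_cases hc : central u
      · obtain ⟨x, hx, hx1, hx2⟩ := hc
        obtain ⟨y, hy, hy1, hy2⟩ := h3.1 ⟨x, hx, hx1, hx2⟩
        rw [← haE u v h1] at hy2
        rw [← hSE u v h1] at hy
        exact ⟨x, a u, y, hx.1, (haS u).1, hy.1, hx1, hx2, near_symm _ _ hy2, near_symm _ _ hy1⟩
      · obtain ⟨x, hx, hx1⟩ := id hu
        obtain ⟨y, hy, hy1⟩ := h2.1 hu
        have hyu := hy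
        rw [← hSE u v h1] at hyu
        refine ⟨x, y, y, hx.1, hyu.1, hyu.1, hx1, ?_, near_refl y, near_symm _ _ hy1⟩
        rcases hnear (ρ u) x y (a u) ((P _).trans ((P _).symm hx.1) hyu.1)
          ((P _).trans ((P _).symm hx.1) (haS u).1) hx.2 hyu.2 (haS u).2 with h | h | h
        · exact h
        · exact absurd ⟨y, hy, hy1, haE u v h1 ▸ h⟩ (h3.not.1 hc)
        · exact absurd ⟨x, hx, hx1, h⟩ hc
    · rw [hb u hu]
      have hv := h2.not.1 hu
      obtain ⟨h5, h6⟩ := h4 hu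
      obtain ⟨x, hx, hx1, hx2⟩ := hρ' u hu
      obtain ⟨y, hy, hy1, hy2⟩ := hρ' v hv
      have hux : P (ρ' u) u x := hP (hτρ' u) ((P _).symm hx1.1)
      have huy : P (ρ' u) u y := (P _).trans h6 (h5 ▸ hP (hτρ' v) ((P _).symm hy1.1))
      refine ⟨x, y, y, hux, huy, huy, ?_, ?_, near_refl y, ?_⟩
      · exact hbad (τ u) u x hu hx (E.symm hx1.2) ((P _).symm hx1.1) le_rfl
          ((hτρ' u).trans hx2)
      · exact hbad (ρ' u) x y hx hy (E.trans hx1.2 (E.trans h1 (E.symm hy1.2)))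
          ((P _).trans ((P _).symm hux) huy) hx2 (h5 ▸ hy2)
      · exact hbad (τ v) y v hy hv hy1.2 hy1.1 ((hτρ' v).trans hy2) le_rfl
  · intro s u v huv hu hv hcode
    simp only [Prod.mk.injEq, decide_eq_decide] at hcode
    obtain ⟨hc1, hc2, hc3⟩ := hcode
    have hρu : s ≤ ρ u := by
      by_cases h : good u
      · exact hu.trans (hg u h).le
      · exact hu.trans ((hb u h).trans_le (hρ'ρ u h))
    have hρv : s ≤ ρ v := by
      by_cases h : good v
      · exact hv.trans (hg v h).le
      · exact hv.trans ((hb v h).trans_le (hρ'ρ v h))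
    have hEuv : E u v := by
      refine hEgood s u v huv hρu ?_
      have h1 := hρr u trivial s hρu
      have h2 := hρr v trivial s hρv
      have h3 := hr s u v huv
      omega
    by_cases h : good u
    · have h' := hc2.1 h
      simp only [if_pos h, if_pos h', decide_eq_decide] at hc3
      exact ⟨hEuv, hc2, hc3, fun h'' => absurd h h''⟩
    · have h' := hc2.not.1 h
      simp only [if_neg h, if_neg h', decide_eq_decide] at hc3
      rw [hb u h] at hu
      rw [hb v h'] at hv
      have hnc : ∀ w, ¬ good w → ¬ central w := fun w hw ⟨x, hx, hx1, _⟩ => hw ⟨x, hx, hx1⟩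
      refine ⟨hEuv, hc2, iff_of_false (hnc u h) (hnc v h'), fun _ => ?_⟩
      have h1 := hρr' u h s hu
      have h2 := hρr' v h' s hv
      have h3 := hr' s u v ⟨huv, hEuv⟩
      exact ⟨by omega, hP hu huv⟩

end Clustering

/-! ### Bounded expansion from reachability -/

section Reach

/-- The vertices of lifetime at least `ℓ x` that can be reached from `x` by a walk of length at most
`k` all of whose other vertices have lifetime at most `ℓ x`. -/
def StrongReach {W : Type u} (H : SimpleGraph W) (ℓ : W → ℕ) (k : ℕ) (x : W) : Set W :=
  {y | ℓ x ≤ ℓ y ∧ ∃ p : H.Walk x y, p.length ≤ k ∧ ∀ z ∈ p.support, z = y ∨ ℓ z ≤ ℓ x}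

/-- The vertices that can be reached from `x` by a walk of length at most `k` on which they have
the maximum lifetime. -/
def WeakReach {W : Type u} (H : SimpleGraph W) (ℓ : W → ℕ) (k : ℕ) (x : W) : Set W :=
  {y | ∃ p : H.Walk x y, p.length ≤ k ∧ ∀ z ∈ p.support, ℓ z ≤ ℓ y}

theorem SimpleGraph.Walk.exists_first_ge {W : Type u} {H : SimpleGraph W} (ℓ : W → ℕ) (s : ℕ)
    {a y : W} (p : H.Walk a y) (hs : s ≤ ℓ y) :
    ∃ (z : W) (q : H.Walk a z) (q' : H.Walk z y), q.length + q'.length = p.length ∧ s ≤ ℓ z ∧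
      (∀ w ∈ q.support, w = z ∨ ℓ w ≤ s) ∧ ∀ w ∈ q'.support, w ∈ p.support := by
  induction p with
  | nil => exact ⟨_, .nil, .nil, rfl, hs, by simp, by simp⟩
  | @cons a b y h p ih =>
    rcases le_or_gt s (ℓ a) with h1 | h1
    · exact ⟨a, .nil, .cons h p, by simp, h1, by simp, fun _ => id⟩
    · obtain ⟨z, q, q', h2, h3, h4, h5⟩ := ih hs
      refine ⟨z, .cons h q, q', ?_, h3, ?_, ?_⟩
      · simp only [SimpleGraph.Walk.length_cons]
        omega
      · intro w hw
        rw [SimpleGraph.Walk.support_cons, List.mem_cons] at hw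
        rcases hw with rfl | hw
        · exact Or.inr h1.le
        · exact h4 w hw
      · intro w hw
        exact List.mem_cons_of_mem _ (h5 w hw)

theorem Set.ncard_biUnion_le_mul {α β : Type*} [Finite α] (s : Set α) (f : α → Set β)
    (n : ℕ) (h : ∀ a ∈ s, (f a).ncard ≤ n) : (⋃ a ∈ s, f a).ncard ≤ s.ncard * n := by
  have hs := s.toFinite
  have h1 := Finset.set_ncard_biUnion_le hs.toFinset f
  simp only [Set.Finite.mem_toFinset] at h1
  refine h1.trans ((Finset.sum_le_card_nsmul _ _ n fun a ha => h a (hs.mem_toFinset.1 ha)).trans ?_)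
  rw [smul_eq_mul, Set.ncard_eq_toFinset_card s hs]

/-- Cut a walk at the first vertex `z` after its start with lifetime at least `ℓ x`: `z` is strongly
reachable, and the rest is a shorter weakly reaching walk. Lifetimes may tie. -/
theorem ncard_weakReach_le {W : Type u} [Finite W] (H : SimpleGraph W) (ℓ : W → ℕ) (k c : ℕ)
    (hc : ∀ x, (StrongReach H ℓ k x).ncard ≤ c) (n : ℕ) (hn : n ≤ k) (x : W) :
    (WeakReach H ℓ n x).ncard ≤ (c + 1) ^ n := by
  induction n generalizing x with
  | zero =>
    have : WeakReach H ℓ 0 x ⊆ {x} := by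
      rintro y ⟨p, hp, -⟩
      exact (SimpleGraph.Walk.eq_of_length_eq_zero (Nat.le_zero.1 hp)).symm
    simpa using Set.ncard_le_ncard this
  | succ n ih =>
    have hsub : WeakReach H ℓ (n + 1) x ⊆
        {x} ∪ ⋃ z ∈ StrongReach H ℓ k x, WeakReach H ℓ n z := by
      rintro y ⟨p, hp, hy⟩
      cases p with
      | nil => exact Or.inl rfl
      | @cons _ b _ h p =>
        right
        obtain ⟨z, q, q', h1, h2, h3, h4⟩ := p.exists_first_ge ℓ (ℓ x) (hy x (by simp))
        rw [SimpleGraph.Walk.length_cons] at hp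
        refine Set.mem_biUnion (x := z) ⟨h2, .cons h q, ?_, ?_⟩ ⟨q', ?_, fun w hw => ?_⟩
        · rw [SimpleGraph.Walk.length_cons]
          omega
        · intro w hw
          rw [SimpleGraph.Walk.support_cons, List.mem_cons] at hw
          rcases hw with rfl | hw
          · exact Or.inr le_rfl
          · exact h3 w hw
        · omega
        · exact hy w (List.mem_cons_of_mem _ (h4 w hw))
    have h1 := Set.ncard_le_ncard hsub
    have h2 := Set.ncard_union_le {x} (⋃ z ∈ StrongReach H ℓ k x, WeakReach H ℓ n z)
    have h3 := Set.ncard_biUnion_le_mul (StrongReach H ℓ k x) (WeakReach H ℓ n) _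
      fun z _ => ih (by omega) z
    have h4 := Nat.mul_le_mul_right ((c + 1) ^ n) (hc x)
    have h5 : 1 ≤ (c + 1) ^ n := Nat.one_le_pow _ _ (Nat.succ_pos c)
    rw [Set.ncard_singleton] at h2
    rw [pow_succ]
    linarith

theorem exists_walk_of_radius_le {V : Type u} {G : SimpleGraph V} {B : Set V} {r : ℕ}
    (h : (G.induce B).radius ≤ r) {x y : V} (hx : x ∈ B) (hy : y ∈ B) :
    ∃ p : G.Walk x y, p.length ≤ 2 * r ∧ ∀ z ∈ p.support, z ∈ B := by
  have h1 : (G.induce B).edist ⟨x, hx⟩ ⟨y, hy⟩ ≤ (2 * r : ℕ) := by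
    have : Nonempty B := ⟨⟨x, hx⟩⟩
    refine SimpleGraph.edist_le_ediam.trans (SimpleGraph.ediam_le_two_mul_radius.trans ?_)
    push_cast
    gcongr
  obtain ⟨p, hp⟩ := SimpleGraph.exists_walk_of_edist_ne_top
    (ne_top_of_le_ne_top (ENat.natCast_ne_top _) h1)
  rw [← hp] at h1
  have key : ∀ {a b : B} (p : (G.induce B).Walk a b),
      ∃ q : G.Walk (a : V) (b : V), q.length = p.length ∧ ∀ z ∈ q.support, z ∈ B := by
    intro a b p
    induction p with
    | @nil a => exact ⟨.nil, rfl, by simp⟩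
    | @cons a a' b h p ih =>
      obtain ⟨q, hq, hqB⟩ := ih
      have h' : G.Adj a a' := h
      refine ⟨.cons h' q, by simp [hq], fun z hz => ?_⟩
      rw [SimpleGraph.Walk.support_cons, List.mem_cons] at hz
      rcases hz with rfl | hz
      · exact a.2
      · exact hqB z hz
  obtain ⟨q, hq, hqB⟩ := key p
  exact ⟨q, hq ▸ (by exact_mod_cast h1), hqB⟩

theorem nonempty_of_radius_le {V : Type u} {G : SimpleGraph V} {B : Set V} {r : ℕ}
    (h : (G.induce B).radius ≤ r) : B.Nonempty := by
  by_contra hB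
  have : IsEmpty B := Set.isEmpty_coe_sort.2 (Set.not_nonempty_iff_eq_empty.1 hB)
  rw [SimpleGraph.radius_eq_top_of_isEmpty] at h
  exact ENat.natCast_ne_top r (top_le_iff.1 h)

/-- A graph with few weakly reachable vertices has sparse shallow minors. -/
theorem ncard_edgeSet_le_of_isShallowMinor {U : Type v} {V : Type u} [Finite U] [Finite V]
    {M : SimpleGraph U} {H : SimpleGraph V} {r c : ℕ} (ℓ : V → ℕ)
    (hc : ∀ x, (WeakReach H ℓ (4 * r + 1) x).ncard ≤ c) (hM : IsShallowMinor r M H) :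
    M.edgeSet.ncard ≤ c * Nat.card U := by
  obtain ⟨B, hdisj, hrad, hadj⟩ := hM
  have hmax : ∀ a, ∃ x ∈ B a, ∀ z ∈ B a, ℓ z ≤ ℓ x := fun a =>
    Set.exists_max_image (B a) ℓ (Set.toFinite _) (nonempty_of_radius_le (hrad a))
  -- Each branch set is represented by a vertex of maximum lifetime. An edge is charged to the end
  -- with the smaller lifetime, via a walk of length `2r + 1 + 2r`.
  choose x hx hmax using hmax
  have hinj : Function.Injective x := by
    intro a b hab
    by_contra hne
    exact Set.disjoint_left.1 (hdisj a b hne) (hx a) (hab ▸ hx b)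
  have hreach : ∀ a b, M.Adj a b → ℓ (x a) ≤ ℓ (x b) →
      x b ∈ WeakReach H ℓ (4 * r + 1) (x a) := by
    intro a b hab hle
    obtain ⟨y, hy, z, hz, hyz⟩ := hadj a b hab
    obtain ⟨p, hp, hpB⟩ := exists_walk_of_radius_le (hrad a) (hx a) hy
    obtain ⟨q, hq, hqB⟩ := exists_walk_of_radius_le (hrad b) hz (hx b)
    refine ⟨p.append (.cons hyz q), ?_, ?_⟩
    · rw [SimpleGraph.Walk.length_append, SimpleGraph.Walk.length_cons]
      omega
    · intro w hw
      rw [SimpleGraph.Walk.mem_support_append_iff, SimpleGraph.Walk.support_cons,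
        List.mem_cons] at hw
      rcases hw with hw | rfl | hw
      · exact (hmax a w (hpB w hw)).trans hle
      · exact (hmax a _ hy).trans hle
      · exact hmax b w (hqB w hw)
  have hsub : M.edgeSet ⊆ ⋃ a ∈ (Set.univ : Set U),
      (fun b => s(a, b)) '' (x ⁻¹' WeakReach H ℓ (4 * r + 1) (x a)) := by
    intro e he
    induction e with
    | h a b =>
      rcases le_total (ℓ (x a)) (ℓ (x b)) with h | h
      · exact Set.mem_biUnion (Set.mem_univ a) ⟨b, hreach a b he h, rfl⟩
      · exact Set.mem_biUnion (Set.mem_univ b) ⟨a, hreach b a he.symm h, Sym2.eq_swap⟩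
  refine (Set.ncard_le_ncard hsub (Set.toFinite _)).trans
    ((Set.ncard_biUnion_le_mul _ _ c fun a _ => ?_).trans ?_)
  · refine (Set.ncard_image_le (Set.toFinite _)).trans ((Set.ncard_le_ncard_of_injOn x
      (fun _ h => h) hinj.injOn (Set.toFinite _)).trans (hc _))
  · rw [Set.ncard_univ, mul_comm]

theorem boundedExpansion_of_ncard_strongReach_le (g : ℕ → ℕ) :
    BoundedExpansion {H : FinGraph.{u} | ∃ ℓ : H.V → ℕ, ∀ k x,
      (StrongReach H.graph ℓ k x).ncard ≤ g k} := by
  intro r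
  refine ⟨(g (4 * r + 1) + 1) ^ (4 * r + 1), ?_⟩
  rintro H ⟨ℓ, hℓ⟩ M hM
  exact ncard_edgeSet_le_of_isShallowMinor ℓ
    (fun x => ncard_weakReach_le H.graph ℓ _ _ (hℓ _) _ le_rfl x) hM

end Reach

/-! ### Resolved edges and clusters in a merge sequence -/

section MergeSequences

variable {V : Type u}

/-- A merge sequence can be continued to a sequence indexed by all natural numbers in which
eventually all pairs are resolved. -/
theorem MergeSequence.exists_nat_sequence {G : SimpleGraph V} (S : MergeSequence G) (f : ℕ → ℕ)
    (hf : ∀ r, S.width r ≤ f r) :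
    ∃ (P : ℕ → Setoid V) (R : ℕ → SimpleGraph V), Monotone P ∧ Monotone R ∧ P 0 = ⊥ ∧
      (∀ t, HomogeneousModulo G (P t) (R t)) ∧ (∃ m, ∀ t, m < t → R t = ⊤) ∧
      ∀ t r v, (quotientSet (P t) (graphBall (R (t + 1)) r v)).encard ≤ (f r + 1 : ℕ) := by
  let P : ℕ → Setoid V := fun t => if h : t < S.m + 1 then S.P ⟨t, h⟩ else ⊤
  let R : ℕ → SimpleGraph V := fun t => if h : t < S.m + 1 then S.R ⟨t, h⟩ else ⊤
  have hP : ∀ t (h : t < S.m + 1), P t = S.P ⟨t, h⟩ := fun t h => dif_pos h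
  have hR : ∀ t (h : t < S.m + 1), R t = S.R ⟨t, h⟩ := fun t h => dif_pos h
  have hR' : ∀ t, S.m < t → R t = ⊤ := fun t h => dif_neg (by omega)
  have hP' : ∀ t, S.m ≤ t → P t = ⊤ := by
    intro t h
    rcases h.eq_or_lt with rfl | h
    · rw [hP _ (Nat.lt_succ_self _)]
      exact S.P_last
    · exact dif_neg (by omega)
  refine ⟨P, R, ?_, ?_, ?_, ?_, ⟨S.m, hR'⟩, ?_⟩
  · intro s t hst
    rcases le_or_gt S.m t with h | h
    · rw [hP' t h]
      exact le_top
    · rw [hP s (by omega), hP t (by omega)]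
      exact S.P_mono hst
  · intro s t hst
    rcases lt_or_ge S.m t with h | h
    · rw [hR' t h]
      exact le_top
    · rw [hR s (by omega), hR t (by omega)]
      exact S.R_mono hst
  · rw [hP 0 (by omega)]
    exact S.P_first
  · intro t
    rcases lt_or_ge S.m t with h | h
    · rw [hR' t h]
      intro X _ Y _ x _ y _ x' _ y' _ hxy _ hR₁ _
      exact absurd hxy hR₁
    · rw [hR t (by omega), hP t (by omega)]
      exact S.homogeneous _
  · intro t r v
    rcases le_or_gt S.m t with h | h
    · rw [hP' t h]
      -- The width ignores the last step; the single part present from then on accounts for the `+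
      -- 1`.
      refine le_trans (Set.encard_le_one_iff.2 ?_) (by exact_mod_cast Nat.le_add_left 1 (f r))
      rintro X Y ⟨hX, x, hx, -⟩ ⟨hY, y, hy, -⟩
      obtain ⟨a, rfl⟩ := hX
      obtain ⟨b, rfl⟩ := hY
      rfl
    · have h1 : pairWidth (S.P (Fin.castSucc ⟨t, h⟩)) (S.R (Fin.succ ⟨t, h⟩)) r ≤ f r :=
        le_trans (le_iSup (fun t : Fin S.m => pairWidth (S.P t.castSucc) (S.R t.succ) r) ⟨t, h⟩)
          (hf r)
      rw [hP t (by omega), hR (t + 1) (by omega)]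
      refine le_trans (le_trans (le_iSup (fun v => (quotientSet _ (graphBall _ r v)).encard) v) h1)
        (by exact_mod_cast Nat.le_succ _)

theorem HomogeneousModulo.adj_of_adj {G : SimpleGraph V} {P : Setoid V} {R : SimpleGraph V}
    (h : HomogeneousModulo G P R) {x y b : V} (hxy : P x y) (hxb : G.Adj x b) (hR : ¬ R.Adj x b)
    (hyb : y ≠ b) (hR' : ¬ R.Adj y b) : G.Adj y b :=
  (h _ (P.mem_classes x) _ (P.mem_classes b) x (P.refl x) b (P.refl b) y (P.symm hxy) b (P.refl b)
    hxb.ne hyb hR hR').1 hxb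

theorem SimpleGraph.not_adj_of_three_lt_edist {R : SimpleGraph V} {x y : V}
    (h : 3 < R.edist x y) : ¬ R.Adj x y := by
  intro h'
  rw [SimpleGraph.edist_eq_one_iff_adj.2 h'] at h
  exact absurd h (by decide)

/-- The vertices incident with an edge of `G` whose ends have distance more than three in `R`. -/
def unresolvedVerts (G R : SimpleGraph V) : Set V :=
  {v | ∃ w, G.Adj v w ∧ 3 < R.edist v w}

theorem edist_le_three_of_notMem_unresolvedVerts {G R : SimpleGraph V} {v w : V}
    (hv : v ∉ unresolvedVerts G R) (h : G.Adj v w) : R.edist v w ≤ 3 := by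
  by_contra h'
  exact hv ⟨w, h, not_le.1 h'⟩

/-- If all three distances exceed 2, no two of the vertices share a neighbour. A far neighbour of
one must then be joined in `R` to the other two, and `x, b, z, a` is a walk of length 3 in `R` to a
far neighbour `a` of `x`. This is where the threshold 3 comes from. -/
theorem HomogeneousModulo.near_of_mem_unresolvedVerts {G : SimpleGraph V} {P : Setoid V}
    {R : SimpleGraph V} (h : HomogeneousModulo G P R) {x y z : V} (hxy : P x y) (hxz : P x z)
    (hx : x ∈ unresolvedVerts G R) (hy : y ∈ unresolvedVerts G R) (hz : z ∈ unresolvedVerts G R) :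
    G.edist x y ≤ 2 ∨ G.edist y z ≤ 2 ∨ G.edist x z ≤ 2 := by
  by_contra! hcon
  obtain ⟨hxy', hyz', hxz'⟩ := hcon
  have key : ∀ u v c, P u v → 2 < G.edist u v → G.Adj u c → 3 < R.edist u c → R.Adj v c := by
    intro u v c huv hd huc hc
    rw [SimpleGraph.two_lt_edist_iff] at hd
    obtain ⟨h1, h2, h3⟩ := hd
    by_contra hR
    have hvc := h.adj_of_adj huv huc (SimpleGraph.not_adj_of_three_lt_edist hc)
      (by rintro rfl; exact h2 huc) hR
    have : c ∈ G.commonNeighbors u v := ⟨huc, hvc⟩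
    rw [h3] at this
    exact this
  obtain ⟨a, hxa, ha⟩ := hx
  obtain ⟨b, hyb, hb⟩ := hy
  obtain ⟨c, hzc, hc⟩ := hz
  have h1 := key y x b (P.symm hxy) (by rwa [SimpleGraph.edist_comm]) hyb hb
  have h2 := key y z b (P.trans (P.symm hxy) hxz) hyz' hyb hb
  have h3 := key x z a hxz hxz' hxa ha
  have h4 := SimpleGraph.edist_le (.cons h1 (.cons h2.symm (.cons h3 .nil)) : R.Walk x a)
  exact absurd ha (not_lt.2 h4)

theorem edist_le_six_of_near {G R : SimpleGraph V} {x y : V} (hx : x ∉ unresolvedVerts G R)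
    (hy : y ∉ unresolvedVerts G R) (h : G.edist x y ≤ 2) : R.edist x y ≤ 6 := by
  by_cases h0 : x = y
  · subst h0
    simp
  by_cases h1 : G.Adj x y
  · exact (edist_le_three_of_notMem_unresolvedVerts hx h1).trans (by decide)
  · have h2 : G.commonNeighbors x y ≠ ∅ := by
      intro h2
      exact absurd (SimpleGraph.two_lt_edist_iff.2 ⟨h0, h1, h2⟩) (not_lt.2 h)
    obtain ⟨w, hw, hw'⟩ := Set.nonempty_iff_ne_empty.2 h2
    have h3 := edist_le_three_of_notMem_unresolvedVerts hx hw
    have h4 := edist_le_three_of_notMem_unresolvedVerts hy hw'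
    rw [SimpleGraph.edist_comm] at h4
    exact SimpleGraph.edist_triangle.trans ((add_le_add h3 h4).trans (by decide))

theorem HomogeneousModulo.edist_le_three {G : SimpleGraph V} {P : Setoid V} {R : SimpleGraph V}
    (h : HomogeneousModulo G P R) {x c v : V} (hxc : G.Adj x c) (hc : 3 < R.edist x c)
    (hxv : P x v) (hv : v ∉ unresolvedVerts G R) : R.edist v c ≤ 3 := by
  by_cases hR : R.Adj v c
  · rw [SimpleGraph.edist_eq_one_iff_adj.2 hR]
    decide
  · refine edist_le_three_of_notMem_unresolvedVerts hv
      (h.adj_of_adj hxv hxc (SimpleGraph.not_adj_of_three_lt_edist hc) ?_ hR)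
    rintro rfl
    exact hv ⟨x, hxc.symm, by rwa [SimpleGraph.edist_comm]⟩

theorem edist_le_of_chain (G : SimpleGraph V) {u x y z v : V} {n : ℕ∞} (h₁ : G.edist u x ≤ n)
    (h₂ : G.edist x y ≤ n) (h₃ : G.edist y z ≤ n) (h₄ : G.edist z v ≤ n) :
    G.edist u v ≤ n + n + n + n :=
  SimpleGraph.edist_triangle.trans (add_le_add (SimpleGraph.edist_triangle.trans
    (add_le_add (SimpleGraph.edist_triangle.trans (add_le_add h₁ h₂)) h₃)) h₄)

/-- The vertex set of a graph with a merge sequence can be partitioned into clusters of bounded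
diameter, with lifetimes `ℓ`, such that the pairs resolved right after the end of the lifetime of a
cluster connect the cluster and all its incident edges by short walks, and each part at time `s`
meets at most eight clusters that live until time `s`. -/
theorem exists_graph_clustering {G : SimpleGraph V} {P : ℕ → Setoid V} {R : ℕ → SimpleGraph V}
    (hP : Monotone P) (hR : Monotone R) (hP0 : P 0 = ⊥)
    (hhom : ∀ t, HomogeneousModulo G (P t) (R t)) {m : ℕ} (hm : ∀ t, m < t → R t = ⊤) :
    ∃ (Q : Setoid V) (ℓ : V → ℕ) (code : ℕ → V → Bool × Bool × Bool),
      (∀ u v, Q u v → ℓ u = ℓ v) ∧ (∀ u v, Q u v → G.edist u v ≤ 8) ∧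
      (∀ s u v, Q u v → ℓ u ≤ s → (R (s + 1)).edist u v ≤ 24) ∧
      (∀ s u v, G.Adj u v → ℓ u ≤ s → (R (s + 1)).edist u v ≤ 3) ∧
      ∀ s u v, P s u v → s ≤ ℓ u → s ≤ ℓ v → code s u = code s v → Q u v := by
  classical
  let Z : ℕ → Set V := fun t => unresolvedVerts G (R t)
  have hZ : Antitone Z := by
    rintro s t hst v ⟨w, hw, hw'⟩
    exact ⟨w, hw, hw'.trans_le (SimpleGraph.edist_anti (hR hst))⟩
  have hZm : ∀ t v, v ∈ Z t → t ≤ m := by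
    rintro t v ⟨w, hw, hw'⟩
    by_contra h
    rw [hm t (not_le.1 h), SimpleGraph.edist_top_of_ne hw.ne] at hw'
    exact absurd hw' (by decide)
  let τ : V → ℕ := fun v => Nat.findGreatest (fun t => v ∈ Z t) m
  have hτm : ∀ v, τ v ≤ m := fun v => Nat.findGreatest_le m
  have hτ : ∀ t v, v ∈ Z t → t ≤ τ v := fun t v h => Nat.le_findGreatest (hZm t v h) h
  have hτ' : ∀ t v, t ≠ 0 → t ≤ τ v → v ∈ Z t := by
    intro t v h0 h
    have h1 : τ v ≠ 0 := by omega
    exact hZ h (Nat.findGreatest_of_ne_zero (P := fun t => v ∈ Z t) rfl h1)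
  obtain ⟨Q, ℓ, code, h1, h2, h3, h4, h5⟩ := exists_clustering hP hτm
    (near := fun u v => G.edist u v ≤ 2) (fun v => by simp)
    (fun u v h => by rwa [SimpleGraph.edist_comm]) (by
      intro t x y z hxy hxz hx hy hz
      -- `findGreatest` also returns 0 for vertices never unresolved, so time 0 is handled by
      -- singleton parts instead.
      rcases eq_or_ne t 0 with rfl | h0
      · rw [hP0] at hxy
        obtain rfl : x = y := hxy
        left
        simp
      · exact (hhom t).near_of_mem_unresolvedVerts hxy hxz (hτ' t x h0 hx) (hτ' t y h0 hy)
          (hτ' t z h0 hz))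
  refine ⟨Q, ℓ, code, h2, fun u v huv => ?_, fun s u v huv hs => ?_, fun s u v huv hs => ?_, h5⟩
  · obtain ⟨x, y, z, -, -, -, ha, hb, hc, hd⟩ := h4 u v huv
    exact (edist_le_of_chain G ha hb hc hd).trans (by decide)
  · obtain ⟨x, y, z, hx, hy, hz, ha, hb, hc, hd⟩ := h4 u v huv
    have hout : ∀ w, ℓ w ≤ s → w ∉ Z (s + 1) := by
      intro w hw hw'
      have := hτ _ w hw'
      have := h1 w
      omega
    have hu := hout u hs
    have hv := hout v (h2 u v huv ▸ hs)
    have hP' : P (ℓ u) ≤ P (s + 1) := hP (hs.trans s.le_succ)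
    -- If a chain vertex `w` is still unresolved, homogeneity puts both `u` and `v` within 3 of its
    -- far neighbour `c`. Otherwise each of the four links costs at most 6.
    have key : ∀ w, P (ℓ u) u w → w ∈ Z (s + 1) → (R (s + 1)).edist u v ≤ 24 := by
      rintro w hw ⟨c, hwc, hc⟩
      have h6 := (hhom (s + 1)).edist_le_three hwc hc ((P _).symm (hP' hw)) hu
      have h7 := (hhom (s + 1)).edist_le_three hwc hc
        ((P _).trans ((P _).symm (hP' hw)) (hP' (h3 u v huv))) hv
      rw [SimpleGraph.edist_comm] at h7
      exact SimpleGraph.edist_triangle.trans ((add_le_add h6 h7).trans (by decide))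
    by_cases hx' : x ∈ Z (s + 1)
    · exact key x hx hx'
    by_cases hy' : y ∈ Z (s + 1)
    · exact key y hy hy'
    by_cases hz' : z ∈ Z (s + 1)
    · exact key z hz hz'
    exact (edist_le_of_chain _ (edist_le_six_of_near hu hx' ha) (edist_le_six_of_near hx' hy' hb)
      (edist_le_six_of_near hy' hz' hc) (edist_le_six_of_near hz' hv hd)).trans (by decide)
  · refine edist_le_three_of_notMem_unresolvedVerts (fun hu => ?_) huv
    have := hτ _ u hu
    have := h1 u
    omega

end MergeSequences

/-! ### The quotient by the clusters: distances and sparsity -/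

section QuotientGraph

variable {V : Type u}

/-- The graph obtained from `G` by identifying the vertices in each class of `Q`. -/
def quotientGraph (G : SimpleGraph V) (Q : Setoid V) : SimpleGraph (Quotient Q) where
  Adj X Y := X ≠ Y ∧ ∃ u v, Quotient.mk Q u = X ∧ Quotient.mk Q v = Y ∧ G.Adj u v
  symm := ⟨fun _ _ ⟨h, u, v, hu, hv, huv⟩ => ⟨h.symm, v, u, hv, hu, huv.symm⟩⟩
  loopless := ⟨fun _ h => h.1 rfl⟩

theorem edist_quotientGraph_le (G : SimpleGraph V) (Q : Setoid V) (u v : V) :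
    (quotientGraph G Q).edist (Quotient.mk Q u) (Quotient.mk Q v) ≤ G.edist u v := by
  have key : ∀ (u v : V) (p : G.Walk u v),
      (quotientGraph G Q).edist (Quotient.mk Q u) (Quotient.mk Q v) ≤ p.length := by
    intro u v p
    induction p with
    | nil => simp
    | @cons u w v h p ih =>
      refine SimpleGraph.edist_triangle (v := Quotient.mk Q w) |>.trans ?_
      rw [SimpleGraph.Walk.length_cons, Nat.cast_add, add_comm, Nat.cast_one]
      refine add_le_add ih (SimpleGraph.edist_le_one_iff_adj_or_eq.2 ?_)
      by_cases h' : Quotient.mk Q u = Quotient.mk Q w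
      · exact Or.inr h'
      · exact Or.inl ⟨h', u, w, rfl, rfl, h⟩
  by_cases h : G.edist u v = ⊤
  · rw [h]
    exact le_top
  · obtain ⟨p, hp⟩ := SimpleGraph.exists_walk_of_edist_ne_top h
    exact hp ▸ key u v p

theorem edist_le_of_quotientGraph (G : SimpleGraph V) (Q : Setoid V) {D : ℕ}
    (hQ : ∀ u v, Q u v → G.edist u v ≤ D) {X Y : Quotient Q} (p : (quotientGraph G Q).Walk X Y)
    (u v : V) (hu : Quotient.mk Q u = X) (hv : Quotient.mk Q v = Y) :
    G.edist u v ≤ ((D + 1) * p.length + D : ℕ) := by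
  induction p generalizing u with
  | nil => simpa using hQ u v (Quotient.exact (hu.trans hv.symm))
  | @cons X X' Y h p ih =>
    obtain ⟨x, x', hx, hx', hadj⟩ := h.2
    have h1 := hQ u x (Quotient.exact (hu.trans hx.symm))
    have h2 := ih x' hx' hv
    have h3 : G.edist x x' ≤ (1 : ℕ) := (SimpleGraph.edist_eq_one_iff_adj.2 hadj).le
    refine (SimpleGraph.edist_triangle.trans (add_le_add h1
      (SimpleGraph.edist_triangle.trans (add_le_add h3 h2)))).trans ?_
    rw [SimpleGraph.Walk.length_cons]
    norm_cast
    exact le_of_eq (by ring)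

theorem isQuasiIsometry_quotientGraph (G : SimpleGraph V) (Q : Setoid V)
    (hQ : ∀ u v, Q u v → G.edist u v ≤ (12 : ℕ)) :
    IsQuasiIsometry 13 12 G (quotientGraph G Q) (Quotient.mk Q) := by
  refine ⟨fun u v => ⟨?_, ?_⟩, fun y => ?_⟩
  · by_cases h : (quotientGraph G Q).edist (Quotient.mk Q u) (Quotient.mk Q v) = ⊤
    · rw [h]
      simp
    · obtain ⟨p, hp⟩ := SimpleGraph.exists_walk_of_edist_ne_top h
      have h1 := edist_le_of_quotientGraph G Q hQ p u v rfl rfl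
      rw [← hp]
      refine ENNReal.div_le_of_le_mul ?_
      refine (ENat.toENNReal_le.2 h1).trans ?_
      simp only [ENat.toENNReal_coe]
      have : (((12 + 1) * p.length + 12 : ℕ) : ℝ≥0∞) ≤ (((p.length + 12) * 13 : ℕ) : ℝ≥0∞) := by
        exact_mod_cast (by omega : (12 + 1) * p.length + 12 ≤ (p.length + 12) * 13)
      refine this.trans (le_of_eq ?_)
      push_cast
      rfl
  · refine (ENat.toENNReal_le.2 (edist_quotientGraph_le G Q u v)).trans ?_
    refine le_add_right (le_mul_of_one_le_left zero_le ?_)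
    norm_cast
  · obtain ⟨x, rfl⟩ := Quotient.exists_rep y
    exact ⟨x, by simp⟩

theorem exists_edist_le_of_walk {G R : SimpleGraph V} {Q : Setoid V} {ℓ : Quotient Q → ℕ} {s : ℕ}
    (h₁ : ∀ u v, Q u v → ℓ (Quotient.mk Q u) ≤ s → R.edist u v ≤ 24)
    (h₂ : ∀ u v, G.Adj u v → ℓ (Quotient.mk Q u) ≤ s → R.edist u v ≤ 3) {X Y : Quotient Q}
    (p : (quotientGraph G Q).Walk X Y) (hp : ∀ z ∈ p.support, z = Y ∨ ℓ z ≤ s) (u : V)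
    (hu : Quotient.mk Q u = X) :
    ∃ v, Quotient.mk Q v = Y ∧ R.edist u v ≤ (27 * p.length : ℕ) := by
  induction p generalizing u with
  | nil => exact ⟨u, hu, by simp⟩
  | @cons X X' Y h p ih =>
    -- The target may outlive `s`, so its inside need not be short in `R`; the lift stops on first
    -- reaching it. Every other step costs 24 inside a cluster and 3 along an edge.
    rcases hp X (by simp) with hXY | hX
    · exact ⟨u, hu.trans hXY, by simp⟩
    · obtain ⟨x, x', hx, hx', hadj⟩ := h.2
      have h3 := h₁ u x (Quotient.exact (hu.trans hx.symm)) (hu ▸ hX)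
      have h4 := h₂ x x' hadj (hx ▸ hX)
      obtain ⟨v, hv, h5⟩ := ih (fun z hz => hp z (List.mem_cons_of_mem _ hz)) x' hx'
      refine ⟨v, hv, (SimpleGraph.edist_triangle.trans (add_le_add h3
        (SimpleGraph.edist_triangle.trans (add_le_add h4 h5)))).trans (le_of_eq ?_)⟩
      rw [SimpleGraph.Walk.length_cons]
      norm_cast
      ring

/-- A reached cluster is determined by the part containing the end of its lifted walk together with
the code of that end. -/
theorem ncard_strongReach_quotientGraph_le [Finite V] {G R : SimpleGraph V} {P Q : Setoid V}
    {ℓ : Quotient Q → ℕ} {β : Type} [Fintype β] (code : V → β) {X : Quotient Q} {k n : ℕ}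
    (h₁ : ∀ u v, Q u v → ℓ (Quotient.mk Q u) ≤ ℓ X → R.edist u v ≤ 24)
    (h₂ : ∀ u v, G.Adj u v → ℓ (Quotient.mk Q u) ≤ ℓ X → R.edist u v ≤ 3)
    (hcode : ∀ u v, P u v → ℓ X ≤ ℓ (Quotient.mk Q u) → ℓ X ≤ ℓ (Quotient.mk Q v) →
      code u = code v → Q u v)
    (hn : ∀ v, (quotientSet P (graphBall R (27 * k) v)).encard ≤ n) :
    (StrongReach (quotientGraph G Q) ℓ k X).ncard ≤ n * Fintype.card β := by
  obtain ⟨x, hx⟩ := Quotient.exists_rep X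
  have h : ∀ Y : Quotient Q, ∃ v, Y ∈ StrongReach (quotientGraph G Q) ℓ k X →
      Quotient.mk Q v = Y ∧ v ∈ graphBall R (27 * k) x := by
    intro Y
    by_cases hY : Y ∈ StrongReach (quotientGraph G Q) ℓ k X
    · obtain ⟨-, p, hpk, hp⟩ := hY
      obtain ⟨v, hv, hv'⟩ := exists_edist_le_of_walk h₁ h₂ p hp x hx
      refine ⟨v, fun _ => ⟨hv, hv'.trans ?_⟩⟩
      exact_mod_cast Nat.mul_le_mul_left 27 hpk
    · exact ⟨x, fun h => absurd h hY⟩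
  choose v hv using h
  have hfin : (quotientSet P (graphBall R (27 * k) x)).Finite := Set.toFinite _
  have hle : (quotientSet P (graphBall R (27 * k) x)).ncard ≤ n := by
    have := hn x
    rw [← hfin.cast_ncard_eq] at this
    exact_mod_cast this
  have h3 : (StrongReach (quotientGraph G Q) ℓ k X).ncard ≤
      (quotientSet P (graphBall R (27 * k) x) ×ˢ (Set.univ : Set β)).ncard := by
    refine Set.ncard_le_ncard_of_injOn (fun Y => ({y | P y (v Y)}, code (v Y))) ?_ ?_
      (Set.toFinite _)
    · intro Y hY
      exact ⟨⟨P.mem_classes _, v Y, P.refl _, (hv Y hY).2⟩, Set.mem_univ _⟩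
    · intro Y hY Y' hY' heq
      obtain ⟨h4, h5⟩ := Prod.mk.inj heq
      have h6 : v Y ∈ {y | P y (v Y')} := h4 ▸ (P.refl (v Y) : v Y ∈ {y | P y (v Y)})
      rw [← (hv Y hY).1, ← (hv Y' hY').1]
      refine Quotient.sound (hcode _ _ h6 ?_ ?_ h5)
      · rw [(hv Y hY).1]
        exact hY.1
      · rw [(hv Y' hY').1]
        exact hY'.1
  rw [Set.ncard_prod, Set.ncard_univ, Nat.card_eq_fintype_card] at h3
  exact h3.trans (Nat.mul_le_mul_right _ hle)

end QuotientGraph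

theorem theorem1p6 (C : Set FinGraph.{u}) (hC : UniversallyBoundedMergeWidth C) :
    ∃ D : Set FinGraph.{u}, BoundedExpansion D ∧
      ∀ G ∈ C, ∃ H ∈ D, QuasiIsometric 13 12 G.graph H.graph := by
  obtain ⟨f, hf⟩ := hC
  refine ⟨_, boundedExpansion_of_ncard_strongReach_le fun k => (f (27 * k) + 1) * 8, ?_⟩
  intro G hG
  obtain ⟨S, hS⟩ := hf G hG
  obtain ⟨P, R, hP, hR, hP0, hhom, ⟨m, hm⟩, hwidth⟩ := S.exists_nat_sequence f hS
  obtain ⟨Q, ℓ, code, h1, h2, h3, h4, h5⟩ := exists_graph_clustering hP hR hP0 hhom hm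
  refine ⟨⟨Quotient Q, quotientGraph G.graph Q⟩, ⟨Quotient.lift ℓ h1, fun k X => ?_⟩,
    Quotient.mk Q, isQuasiIsometry_quotientGraph _ _ fun u v huv => (h2 u v huv).trans (by decide)⟩
  -- Applied with `P` at time `ℓ X` and `R` one step later, the very pairing that the width
  -- controls.
  exact ncard_strongReach_quotientGraph_le (code _) (h3 _) (h4 _) (h5 _) (hwidth _ _)
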